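/- Let $F_3$ be the free group with basis $\{a_1,a_2,a_3\}$. A reduced word in the letters $a_i^{\pm1}$ is palindromic if it coincides with the word obtained by reading its letters in reverse order, and an automorphism of $F_3$ is palindromic if it maps each of $a_1,a_2,a_3$ to a palindromic word. Let $\Pi A(F_3)\le \mathrm{Aut}(F_3)$ be the group of palindromic automorphisms. In a group $G$, two elements $x,y$ are in the same $z$-class if their centralizers $Z_G(x)$ and $Z_G(y)$ are conjugate in $G$. Theorem. The number of $z$-classes of $\Pi A(F_3)$ is infinite. -/

import Mathlib

/-- An element of the free group on the basis `α` is palindromic if its reduced word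
(a list of letters `(a, true)` for `a` and `(a, false)` for `a⁻¹`) reads the same backwards. -/
def IsPalindromic {α : Type*} [DecidableEq α] (w : FreeGroup α) : Prop :=
  w.toWord.reverse = w.toWord

/-- An automorphism of the free group is palindromic if it sends every basis element to a
palindromic word. -/
def IsPalindromicAut {α : Type*} [DecidableEq α] (φ : MulAut (FreeGroup α)) : Prop :=
  ∀ a : α, IsPalindromic (φ (FreeGroup.of a))

/-- Word reversal, as a homomorphism to the opposite group that fixes every basis element. -/
def wordReversal (α : Type*) : FreeGroup α →* (FreeGroup α)ᵐᵒᵖ :=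
  FreeGroup.lift fun a => MulOpposite.op (FreeGroup.of a)

theorem wordReversal_mk {α : Type*} (L : List (α × Bool)) :
    (wordReversal α (FreeGroup.mk L)).unop = FreeGroup.mk L.reverse := by
  induction L with
  | nil => simp [wordReversal, FreeGroup.one_eq_mk]
  | cons x L ih =>
    have h : FreeGroup.mk (x :: L) = FreeGroup.mk [x] * FreeGroup.mk L := by
      simp
    rw [h, map_mul, MulOpposite.unop_mul, ih, List.reverse_cons, ← FreeGroup.mul_mk]
    congr 1
    obtain ⟨a, b⟩ := x
    cases b <;> simp [wordReversal, FreeGroup.of, FreeGroup.invRev]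

theorem isPalindromic_iff_wordReversal {α : Type*} [DecidableEq α] (w : FreeGroup α) :
    IsPalindromic w ↔ wordReversal α w = MulOpposite.op w := by
  have key : (wordReversal α w).unop = FreeGroup.mk w.toWord.reverse := by
    rw [← wordReversal_mk, FreeGroup.mk_toWord]
  have hred : FreeGroup.reduce w.toWord.reverse = w.toWord.reverse := by
    apply FreeGroup.IsReduced.reduce_eq
    have h : FreeGroup.IsReduced w.toWord := FreeGroup.isReduced_toWord
    unfold FreeGroup.IsReduced at h ⊢
    rw [List.isChain_reverse]
    exact h.imp fun a b hab hba => (hab hba.symm).symm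
  constructor
  · intro h
    apply MulOpposite.unop_injective
    rw [key, show w.toWord.reverse = w.toWord from h, FreeGroup.mk_toWord, MulOpposite.unop_op]
  · intro h
    rw [h, MulOpposite.unop_op] at key
    have := congrArg FreeGroup.toWord key
    rw [FreeGroup.toWord_mk, hred] at this
    exact this.symm

theorem isPalindromicAut_iff_wordReversal {α : Type*} [DecidableEq α]
    (φ : MulAut (FreeGroup α)) :
    IsPalindromicAut φ ↔
      ∀ w, wordReversal α (φ w) = MulOpposite.op (φ (wordReversal α w).unop) := by
  constructor
  · intro h
    have e : (wordReversal α).comp φ.toMonoidHom =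
        (MonoidHom.op φ.toMonoidHom).comp (wordReversal α) := by
      apply FreeGroup.ext_hom
      intro a
      have := (isPalindromic_iff_wordReversal _).1 (h a)
      simpa [wordReversal] using this
    intro w
    exact DFunLike.congr_fun e w
  · intro h a
    rw [isPalindromic_iff_wordReversal, h]
    simp [wordReversal]

/-- The palindromic automorphism group `ΠA(F_n)` of the free group `F_n` on `n` generators, as a
subgroup of `Aut(F_n)`. -/
def palindromicAut (n : ℕ) : Subgroup (MulAut (FreeGroup (Fin n))) where
  carrier := {φ | IsPalindromicAut φ}
  one_mem' := by
    intro a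
    simp [IsPalindromic]
  mul_mem' := by
    intro φ χ hφ hχ
    simp only [Set.mem_ofPred_eq, isPalindromicAut_iff_wordReversal] at hφ hχ ⊢
    intro w
    rw [MulAut.mul_apply, hφ, hχ]
    rfl
  inv_mem' := by
    intro φ hφ
    simp only [Set.mem_ofPred_eq, isPalindromicAut_iff_wordReversal] at hφ ⊢
    intro w
    have h := hφ (φ⁻¹ w)
    rw [MulAut.apply_inv_self] at h
    rw [h, MulOpposite.unop_op, MulAut.inv_apply_self, MulOpposite.op_unop]

/-- Two elements of a group `G` are `z`-equivalent if their centralizers are conjugate in `G`. -/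
def ZEquiv {G : Type*} [Group G] (x y : G) : Prop :=
  ∃ g : G, (Subgroup.centralizer {x}).map (MulAut.conj g).toMonoidHom = Subgroup.centralizer {y}

/-- The relation of `z`-equivalence, whose equivalence classes are the `z`-classes of `G`. -/
def zSetoid (G : Type*) [Group G] : Setoid G where
  r := ZEquiv
  iseqv :=
    { refl := fun x => ⟨1, by ext; simp⟩
      symm := by
        rintro x y ⟨g, hg⟩
        refine ⟨g⁻¹, ?_⟩
        rw [← hg, Subgroup.map_map]
        ext
        simp [mul_assoc]
      trans := by
        rintro x y z ⟨g, hg⟩ ⟨h, hh⟩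
        refine ⟨h * g, ?_⟩
        rw [← hh, ← hg, Subgroup.map_map]
        ext
        simp [mul_assoc] }

/-- The set of `z`-classes of a group. -/
def ZClass (G : Type*) [Group G] : Type _ :=
  Quotient (zSetoid G)

open Matrix

/-! Write h_m for `hyperbolicPalindromicAut m`. On the abelianization `ℤ ^ 3` it acts as a 2×2 block
of determinant 1 and discriminant 16m(m+1), plus a fixed vector. If the centralizer of h_q is
conjugate to that of h_p, then a conjugate of h_q commutes with h_p. Its matrix keeps the trace and
determinant of h_q, but commuting with the matrix of h_p forces its block to have the discriminant
of h_p up to a rational square (`exists_discriminant_eq_of_commute`). Prime parameters make these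
square classes differ, so distinct odd primes give distinct z-classes
(`not_zEquiv_hyperbolicPalindromicAut`). -/

/-! ### Action on the abelianization -/

/-- The exponent sums of the letters of a word, as the abelianization map to `ℤ ^ α`. -/
def exponentSum (α : Type*) [DecidableEq α] : FreeGroup α →* Multiplicative (α → ℤ) :=
  FreeGroup.lift fun a => Multiplicative.ofAdd (Pi.single a 1)

/-- The matrix by which an automorphism of a free group acts on the abelianization. -/
def exponentMatrix {α : Type*} [DecidableEq α] (φ : MulAut (FreeGroup α)) : Matrix α α ℤ :=
  Matrix.of fun i j => (exponentSum α (φ (FreeGroup.of j))).toAdd i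

theorem exponentSum_apply {α : Type*} [DecidableEq α] [Fintype α] (φ : MulAut (FreeGroup α))
    (w : FreeGroup α) :
    (exponentSum α (φ w)).toAdd = exponentMatrix φ *ᵥ (exponentSum α w).toAdd := by
  have h : (exponentSum α).comp φ.toMonoidHom =
      (AddMonoidHom.toMultiplicative (Matrix.mulVecLin (exponentMatrix φ)).toAddMonoidHom).comp
        (exponentSum α) := by
    apply FreeGroup.ext_hom
    intro a
    apply Multiplicative.toAdd.injective
    ext i
    simp [exponentMatrix, exponentSum]
  exact congrArg Multiplicative.toAdd (DFunLike.congr_fun h w)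

theorem exponentMatrix_mul {α : Type*} [DecidableEq α] [Fintype α]
    (φ χ : MulAut (FreeGroup α)) :
    exponentMatrix (φ * χ) = exponentMatrix φ * exponentMatrix χ := by
  ext i j
  simp only [exponentMatrix, Matrix.of_apply, MulAut.mul_apply]
  rw [exponentSum_apply]
  rfl

theorem exponentMatrix_one {α : Type*} [DecidableEq α] :
    exponentMatrix (1 : MulAut (FreeGroup α)) = 1 := by
  ext i j
  simp [exponentMatrix, exponentSum, Matrix.one_apply, Pi.single_apply]

theorem exponentMatrix_mul_inv {α : Type*} [DecidableEq α] [Fintype α]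
    (φ : MulAut (FreeGroup α)) : exponentMatrix φ⁻¹ * exponentMatrix φ = 1 := by
  rw [← exponentMatrix_mul, inv_mul_cancel, exponentMatrix_one]

theorem trace_exponentMatrix_conj {α : Type*} [DecidableEq α] [Fintype α]
    (φ χ : MulAut (FreeGroup α)) :
    (exponentMatrix (φ * χ * φ⁻¹)).trace = (exponentMatrix χ).trace := by
  rw [exponentMatrix_mul, exponentMatrix_mul, Matrix.trace_mul_comm, ← mul_assoc,
    exponentMatrix_mul_inv, one_mul]

theorem det_exponentMatrix_conj {α : Type*} [DecidableEq α] [Fintype α]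
    (φ χ : MulAut (FreeGroup α)) :
    (exponentMatrix (φ * χ * φ⁻¹)).det = (exponentMatrix χ).det := by
  rw [exponentMatrix_mul, exponentMatrix_mul, Matrix.det_mul_comm, ← mul_assoc,
    exponentMatrix_mul_inv, one_mul]

/-! ### Palindromic transvections and the hyperbolic family -/

/-- The endomorphism sending `i` to `j ^ k * i * j ^ k` and fixing the other basis elements. -/
def palindromicTransvectionHom {α : Type*} [DecidableEq α] (i j : α) (k : ℤ) :
    FreeGroup α →* FreeGroup α :=
  FreeGroup.lift fun a =>
    if a = i then FreeGroup.of j ^ k * FreeGroup.of i * FreeGroup.of j ^ k else FreeGroup.of a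

theorem palindromicTransvectionHom_comp {α : Type*} [DecidableEq α] {i j : α} (h : i ≠ j)
    {k l : ℤ} (hkl : k + l = 0) :
    (palindromicTransvectionHom i j k).comp (palindromicTransvectionHom i j l) =
      MonoidHom.id _ := by
  obtain rfl : l = -k := by omega
  apply FreeGroup.ext_hom
  intro a
  by_cases ha : a = i
  · subst ha
    simp [palindromicTransvectionHom, h.symm, mul_assoc]
  · simp [palindromicTransvectionHom, ha]

/-- The automorphism sending `i` to `j ^ k * i * j ^ k` and fixing the other basis elements. -/
def palindromicTransvection {α : Type*} [DecidableEq α] {i j : α} (h : i ≠ j) (k : ℤ) :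
    MulAut (FreeGroup α) :=
  MonoidHom.toMulEquiv (palindromicTransvectionHom i j k) (palindromicTransvectionHom i j (-k))
    (palindromicTransvectionHom_comp h (by ring)) (palindromicTransvectionHom_comp h (by ring))

theorem palindromicTransvection_of {α : Type*} [DecidableEq α] {i j : α} (h : i ≠ j) (k : ℤ)
    (a : α) :
    palindromicTransvection h k (FreeGroup.of a) =
      if a = i then FreeGroup.of j ^ k * FreeGroup.of i * FreeGroup.of j ^ k
      else FreeGroup.of a := by
  simp [palindromicTransvection, palindromicTransvectionHom]

theorem isPalindromicAut_palindromicTransvection {α : Type*} [DecidableEq α] {i j : α}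
    (h : i ≠ j) (k : ℤ) : IsPalindromicAut (palindromicTransvection h k) := by
  intro a
  rw [isPalindromic_iff_wordReversal, palindromicTransvection_of]
  split_ifs
  · simp [wordReversal, mul_assoc]
  · simp [wordReversal]

theorem exponentMatrix_palindromicTransvection {α : Type*} [DecidableEq α] {i j : α}
    (h : i ≠ j) (k : ℤ) :
    exponentMatrix (palindromicTransvection h k) = 1 + Matrix.single j i (2 * k) := by
  ext b a
  rw [exponentMatrix, Matrix.of_apply, palindromicTransvection_of]
  by_cases ha : a = i
  · subst ha
    by_cases hb : b = j
    · subst hb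
      simp [exponentSum, h.symm]
      ring
    · simp [exponentSum, Matrix.one_apply, Pi.single_apply, hb, Ne.symm hb]
  · simp [exponentSum, Matrix.one_apply, Pi.single_apply, ha, Ne.symm ha]

/-- A palindromic automorphism acting hyperbolically on the first two coordinates of `ℤ ^ 3`, with
trace `2 + 4 * m` there. -/
def hyperbolicPalindromicAut (m : ℤ) : palindromicAut 3 :=
  ⟨palindromicTransvection (i := 0) (j := 1) (by decide) m,
    isPalindromicAut_palindromicTransvection _ _⟩ *
  ⟨palindromicTransvection (i := 1) (j := 0) (by decide) 1,
    isPalindromicAut_palindromicTransvection _ _⟩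

theorem exponentMatrix_hyperbolicPalindromicAut (m : ℤ) :
    exponentMatrix (hyperbolicPalindromicAut m : MulAut (FreeGroup (Fin 3))) =
      !![1, 2, 0; 2 * m, 1 + 4 * m, 0; 0, 0, 1] := by
  rw [hyperbolicPalindromicAut, Subgroup.coe_mul, exponentMatrix_mul,
    exponentMatrix_palindromicTransvection, exponentMatrix_palindromicTransvection]
  ext i j
  fin_cases i <;> fin_cases j <;>
    simp [Matrix.mul_apply, Fin.sum_univ_three, Matrix.one_apply, Matrix.single_apply] <;> ring

/-! ### Discriminants of commuting matrices -/

/-- A matrix commuting with that of `hyperbolicPalindromicAut m` and with the trace and determinant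
of that of `hyperbolicPalindromicAut l` has the discriminant of the latter up to squares. -/
theorem exists_discriminant_eq_of_commute {m l : ℤ} (hm : m ≠ 0) (B : Matrix (Fin 3) (Fin 3) ℤ)
    (hB : Commute !![1, 2, 0; 2 * m, 1 + 4 * m, 0; 0, 0, 1] B) (htr : B.trace = 3 + 4 * l)
    (hdet : B.det = 1) : ∃ b : ℤ, 4 * (l * (l + 1)) = b ^ 2 * (m * (m + 1)) := by
  have e (i j : Fin 3) := congrFun (congrFun hB.eq i) j
  have e00 := e 0 0
  have e01 := e 0 1
  have e02 := e 0 2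
  have e12 := e 1 2
  have e20 := e 2 0
  have e21 := e 2 1
  simp [Matrix.mul_apply, Fin.sum_univ_three] at e00 e01 e02 e12 e20 e21
  rw [Matrix.trace_fin_three] at htr
  rw [Matrix.det_fin_three] at hdet
  -- As `m ≠ 0`, 1 is not an eigenvalue of the hyperbolic block, so `B` preserves the splitting of
  -- `ℤ ^ 3` into that block and the third axis.
  have h12 : B 1 2 = 0 := by linarith
  have h02 : B 0 2 = 0 := by
    rw [h12] at e12
    simpa [hm] using e12
  have h21 : B 2 1 = 0 := by
    rcases e20 with h | h
    · exact h
    · exact absurd h hm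
  have h20 : B 2 0 = 0 := by
    rw [h21] at e21
    linarith
  -- The block of `B` is a rational combination of the identity and the hyperbolic block, whose
  -- coefficient on the latter is `B 0 1 / 2`.
  have h10 : B 1 0 = m * B 0 1 := by linarith
  have h11 : B 1 1 = B 0 0 + 2 * m * B 0 1 := by linarith
  rw [h02, h12, h20, h21, h10, h11] at hdet
  rw [h11] at htr
  refine ⟨B 0 1, ?_⟩
  generalize B 0 0 = a at *
  generalize B 0 1 = b at *
  generalize B 2 2 = c at *
  have hc : c * (a * (a + 2 * m * b) - m * b ^ 2) = 1 := by linear_combination hdet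
  rcases Int.eq_one_or_neg_one_of_mul_eq_one hc with rfl | rfl
  · have ha : a = 1 + 2 * l - m * b := by linarith
    subst ha
    linear_combination hc
  -- Here the block has determinant -1, which parity excludes: `m * (m + 1)` is even, while `4 * (1
  -- + l) ^ 2 + 1` is odd.
  · exfalso
    have ha : a = 2 + 2 * l - m * b := by linarith
    subst ha
    have key : 4 * (1 + l) ^ 2 + 1 = b ^ 2 * (m * (m + 1)) := by linear_combination -hc
    obtain ⟨r, hr⟩ := (Int.even_mul_succ_self m).two_dvd
    rw [hr] at key
    have : 2 * (b ^ 2 * r - 2 * (1 + l) ^ 2) = 1 := by linear_combination -key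
    omega

/-- The reason is the `q`-adic valuation in 4q(q+1) = b²p(p+1): it is 1 on the left, since `q > 4`,
and even on the right, since `q` divides neither `p` nor `p + 1`. -/
theorem not_zEquiv_hyperbolicPalindromicAut {p q : ℕ} (hq : q.Prime) (hp : 3 ≤ p)
    (hpq : p + 1 < q) :
    ¬ ZEquiv (hyperbolicPalindromicAut q) (hyperbolicPalindromicAut p) := by
  rintro ⟨g, hg⟩
  have hmem : g * hyperbolicPalindromicAut q * g⁻¹ ∈
      Subgroup.centralizer {hyperbolicPalindromicAut p} := by
    rw [← hg]
    exact ⟨hyperbolicPalindromicAut q, by simp [Subgroup.mem_centralizer_singleton_iff], rfl⟩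
  rw [Subgroup.mem_centralizer_singleton_iff] at hmem
  have hcomm := congrArg (fun x : palindromicAut 3 =>
    exponentMatrix (x : MulAut (FreeGroup (Fin 3)))) hmem
  simp only [Subgroup.coe_mul, Subgroup.coe_inv] at hcomm
  rw [exponentMatrix_mul, exponentMatrix_mul (hyperbolicPalindromicAut p).1,
    exponentMatrix_hyperbolicPalindromicAut p] at hcomm
  obtain ⟨b, hb⟩ := exists_discriminant_eq_of_commute (m := p) (l := q) (by positivity) _
    hcomm.symm
    (by
      rw [trace_exponentMatrix_conj, exponentMatrix_hyperbolicPalindromicAut]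
      simp [Matrix.trace_fin_three]
      ring)
    (by
      rw [det_exponentMatrix_conj, exponentMatrix_hyperbolicPalindromicAut]
      simp [Matrix.det_fin_three]
      ring)
  have hqZ : Prime (q : ℤ) := Nat.prime_iff_prime_int.1 hq
  have hnd {n : ℕ} (h0 : 0 < n) (hn : n < q) : ¬ (q : ℤ) ∣ (n : ℤ) := fun h =>
    Nat.not_dvd_of_pos_of_lt h0 hn (Int.natCast_dvd_natCast.1 h)
  have hdvd : (q : ℤ) ∣ b ^ 2 * (p * (p + 1)) := ⟨4 * (q + 1), by rw [← hb]; ring⟩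
  have hqb : (q : ℤ) ∣ b := by
    rcases hqZ.dvd_or_dvd hdvd with h | h
    · exact hqZ.dvd_of_dvd_pow h
    · rcases hqZ.dvd_or_dvd h with h | h
      · exact absurd h (hnd (by omega) (by omega))
      · exact absurd (by exact_mod_cast h) (hnd (n := p + 1) (by omega) hpq)
  obtain ⟨c, rfl⟩ := hqb
  have h4 : 4 * ((q : ℤ) + 1) = q * (c ^ 2 * (p * (p + 1))) :=
    mul_left_cancel₀ hqZ.ne_zero (by linear_combination hb)
  exact hnd (n := 4) (by omega) (by omega)
    ⟨c ^ 2 * (p * (p + 1)) - 4, by push_cast; linear_combination h4⟩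

theorem theoremP3 : Infinite (ZClass (palindromicAut 3)) := by
  have hinf : {p : ℕ | p.Prime ∧ 3 ≤ p}.Infinite := by
    refine Set.infinite_of_not_bddAbove ?_
    rintro ⟨N, hN⟩
    obtain ⟨p, hp, hprime⟩ := Nat.exists_infinite_primes (N + 3)
    have := hN (show p ∈ {p : ℕ | p.Prime ∧ 3 ≤ p} from ⟨hprime, by omega⟩)
    omega
  have := hinf.to_subtype
  have hlt {p q : ℕ} (hp : p.Prime ∧ 3 ≤ p) (hq : q.Prime ∧ 3 ≤ q) (hpq : p < q) :
      ¬ ZEquiv (hyperbolicPalindromicAut q) (hyperbolicPalindromicAut p) := by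
    -- Both primes are odd, so `p < q` improves to `p + 1 < q`.
    have hpo := hp.1.odd_of_ne_two (by omega)
    have hqo := hq.1.odd_of_ne_two (by omega)
    refine not_zEquiv_hyperbolicPalindromicAut hq.1 hp.2 ?_
    obtain ⟨r, rfl⟩ := hpo
    obtain ⟨s, rfl⟩ := hqo
    omega
  refine Infinite.of_injective
    (fun p : {p : ℕ | p.Prime ∧ 3 ≤ p} =>
      (Quotient.mk (zSetoid _) (hyperbolicPalindromicAut (p : ℕ)) : ZClass (palindromicAut 3))) ?_
  rintro ⟨p, hp⟩ ⟨q, hq⟩ h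
  have hz : ZEquiv (hyperbolicPalindromicAut p) (hyperbolicPalindromicAut q) := Quotient.exact h
  rcases lt_trichotomy p q with hpq | hpq | hpq
  · exact absurd ((zSetoid _).symm hz) (hlt hp hq hpq)
  · exact Subtype.ext hpq
  · exact absurd hz (hlt hq hp hpq)
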